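/- Let $\sigma(z)=\max\{z,0\}$ and consider the two-layer ReLU network $f_W(x)=V\sigma(Wx)$ with $W\in\mathbb R^{m\times d}$ and $V\in\mathbb R^{k\times m}$, $k\ge 1$. Given training data $(x_i,y_i)\in\mathbb R^d\times\mathbb R^k$, $i=1,\dots,n$, $n\ge1$, with $\|x_i\|_2=1$, let $$L(W)=\frac1n\sum_{i=1}^n\frac12\|f_W(x_i)-y_i\|_2^2,\qquad \nabla L(W)=\frac1n\sum_{i=1}^n\big((f_W(x_i)-y_i)^\top V\Sigma_i(W)\big)^\top x_i^\top,$$ where $\Sigma_i(W)$ is the diagonal matrix with entries $\sigma'(\langle w_j,x_i\rangle)$, $w_j^\top$ is the $j$-th row of $W$, $\sigma'(z)=\mathbf 1\{z>0\}$ for $z\neq0$, and $\sigma'(0)\in[0,1]$ is an arbitrary fixed value. Let the entries of $W^{(0)}\in\mathbb R^{m\times d}$ and of $V$ be independent, distributed as $N(0,2/m)$ and $N(0,1/k)$ respectively. Write $\|\cdot\|_2$ for the spectral norm, $\|\cdot\|_{2,\infty}$ for the largest Euclidean norm of a row, $\langle\cdot,\cdot\rangle$ for the Frobenius inner product, and $\mathcal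 B(W^{(0)},\tau)=\{W:\|W-W^{(0)}\|_2\le\tau\}$. For every $A>0$ there are constants $C',C'',c>0$, depending only on $A$, such that the following holds for all such $n,m,d,k$ and training data and all $\tau>0$ with $$\tau\le A,\qquad k\le A\,m,\qquad k\le A\,m\tau^{2/3}\log m,\qquad \log n\le A\,m\tau^{2/3}.$$ With probability at least $1-\exp(-c\,m\tau^{2/3})$ over $(W^{(0)},V)$, all $\hat W,\tilde W\in\mathcal B(W^{(0)},\tau)$ satisfy $$L(\tilde W)\le L(\hat W)+\langle\nabla L(\hat W),\tilde W-\hat W\rangle+C'\sqrt{L(\hat W)}\cdot\frac{\tau^{2/3}m\sqrt{\log m}}{\sqrt k}\cdot\|\tilde W-\hat W\|_{2,\infty}+\frac{C''m}{k}\|\tilde W-\hat W\|_2^2 .$$ -/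

import Mathlib

open MeasureTheory ProbabilityTheory
open scoped Matrix NNReal ENNReal

namespace TwoLayerReLU

noncomputable section

/-- The rectified linear unit `σ(z) = max(z, 0)`. -/
def relu (z : ℝ) : ℝ := max z 0

/-- The derivative `σ'` of the rectified linear unit, where `s` is the value chosen for `σ'(0)`. -/
def reluDeriv (s z : ℝ) : ℝ := if 0 < z then 1 else if z < 0 then 0 else s

/-- The two-layer network `f_W(x) = V σ(W x)`, with `σ` applied entrywise. -/
def network {m d k : ℕ} (V : Matrix (Fin k) (Fin m) ℝ) (W : Matrix (Fin m) (Fin d) ℝ)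
    (x : EuclideanSpace ℝ (Fin d)) : EuclideanSpace ℝ (Fin k) :=
  WithLp.toLp 2 (V *ᵥ fun j => relu ((W *ᵥ x.ofLp) j))

/-- The square loss `ℓ(u, y) = ‖u - y‖₂² / 2`. -/
def sqLoss {k : ℕ} (u y : EuclideanSpace ℝ (Fin k)) : ℝ := ‖u - y‖ ^ 2 / 2

/-- The training loss `L(W) = (1/n) ∑ᵢ ℓ(f_W(xᵢ), yᵢ)`. -/
def trainLoss {n m d k : ℕ} (x : Fin n → EuclideanSpace ℝ (Fin d))
    (y : Fin n → EuclideanSpace ℝ (Fin k)) (V : Matrix (Fin k) (Fin m) ℝ)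
    (W : Matrix (Fin m) (Fin d) ℝ) : ℝ :=
  (1 / (n : ℝ)) * ∑ i, sqLoss (network V W (x i)) (y i)

/-- The diagonal matrix `Σᵢ` of activation derivatives, `(Σᵢ)ⱼⱼ = σ'(⟨wⱼ, xᵢ⟩)`. -/
def activation {m d : ℕ} (s : ℝ) (W : Matrix (Fin m) (Fin d) ℝ) (x : EuclideanSpace ℝ (Fin d)) :
    Matrix (Fin m) (Fin m) ℝ :=
  Matrix.diagonal fun j => reluDeriv s ((W *ᵥ x.ofLp) j)

/-- The gradient of the training loss with respect to `W`, as computed by the chain rule: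
`∇L(W) = (1/n) ∑ᵢ ((f_W(xᵢ) - yᵢ)ᵀ V Σᵢ)ᵀ xᵢᵀ`. -/
def gradLoss {n m d k : ℕ} (s : ℝ) (x : Fin n → EuclideanSpace ℝ (Fin d))
    (y : Fin n → EuclideanSpace ℝ (Fin k)) (V : Matrix (Fin k) (Fin m) ℝ)
    (W : Matrix (Fin m) (Fin d) ℝ) : Matrix (Fin m) (Fin d) ℝ :=
  (1 / (n : ℝ)) • ∑ i, Matrix.vecMulVec
    ((network V W (x i) - y i).ofLp ᵥ* (V * activation s W (x i))) (x i).ofLp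

/-- The Frobenius inner product `⟨A, B⟩ = ∑ⱼₗ Aⱼₗ Bⱼₗ`. -/
def frobInner {m d : ℕ} (A B : Matrix (Fin m) (Fin d) ℝ) : ℝ := ∑ j, ∑ l, A j l * B j l

/-- The spectral norm `‖A‖₂`, the operator norm of `A` between Euclidean spaces. -/
def specNorm {m d : ℕ} (A : Matrix (Fin m) (Fin d) ℝ) : ℝ :=
  ‖LinearMap.toContinuousLinearMap (Matrix.toEuclideanLin A)‖

/-- The norm `‖A‖_{2,∞}`, the largest Euclidean norm of a row of `A`. -/
def twoInftyNorm {m d : ℕ} (A : Matrix (Fin m) (Fin d) ℝ) : ℝ :=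
  ⨆ j : Fin m, ‖(WithLp.toLp 2 (A j) : EuclideanSpace ℝ (Fin d))‖

/-- The perturbation region `B(W₀, τ)`. -/
def specBall {m d : ℕ} (W₀ : Matrix (Fin m) (Fin d) ℝ) (τ : ℝ) : Set (Matrix (Fin m) (Fin d) ℝ) :=
  {W | specNorm (W - W₀) ≤ τ}

/-- The law of a `p × q` matrix with independent `N(0, v)` entries. -/
def gaussianMatrix (p q : ℕ) (v : ℝ≥0) : Measure (Fin p → Fin q → ℝ) :=
  Measure.pi fun _ => Measure.pi fun _ => gaussianReal 0 v

/-- The law of the initialization `(W₀, V)`: all entries independent, those of the `m × d` matrix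
`W₀` distributed as `N(0, 2/m)` and those of the `k × m` matrix `V` as `N(0, 1/k)`. -/
def initLaw (m d k : ℕ) : Measure ((Fin m → Fin d → ℝ) × (Fin k → Fin m → ℝ)) :=
  (gaussianMatrix m d (2 / (m : ℝ≥0))).prod (gaussianMatrix k m (1 / (k : ℝ≥0)))

/-- The semi-smoothness inequality at `(W', W)` with `W'` the new and `W` the old point. -/
def SemiSmooth {n m d k : ℕ} (C₁ C₂ s τ : ℝ) (x : Fin n → EuclideanSpace ℝ (Fin d))
    (y : Fin n → EuclideanSpace ℝ (Fin k)) (V : Matrix (Fin k) (Fin m) ℝ)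
    (W' W : Matrix (Fin m) (Fin d) ℝ) : Prop :=
  trainLoss x y V W' ≤ trainLoss x y V W + frobInner (gradLoss s x y V W) (W' - W)
    + C₁ * √(trainLoss x y V W) * (τ ^ (2 / 3 : ℝ) * m * √(Real.log m) / √(k : ℝ))
        * twoInftyNorm (W' - W)
    + C₂ * m / k * specNorm (W' - W) ^ 2

end

end TwoLayerReLU

/-! Write q = m τ^(2/3), D = W' - W and e = f_W(x) - y. The increment of the hidden layer at x
splits as Σ D x + r, where r is the ReLU linearization error. The term e ⬝ V Σ D x averages to the
gradient term. Since ReLU is 1-Lipschitz, the squared increment of the output is at most ‖V‖² ‖D‖₂²,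
and ‖V‖² is of order m / k with high probability. There remains e ⬝ V r.

The vector r is sparse, with entries at most ‖D‖_{2,∞}. A neuron contributes only if its
preactivation at W₀ is at most β in size, or if W or W' moves it by at least that preactivation,
hence by more than β. Chernoff bounds the first kind by O(q) for β = τ^(2/3) / √m. Chebyshev bounds
the second by 2τ² / β² = 2q, so this β balances the two. Thus r lives on O(q) coordinates. Nets and
a union bound over column sets show that every submatrix of V on that many columns has norm of order
√(q log m / k). Hence e ⬝ V r is at most a constant times ‖e‖ q √(log m) / √k ‖D‖_{2,∞}, and
Cauchy–Schwarz over the samples gives √L.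

The deterministic half is `semiSmooth_of_columnBound`; the probabilistic half is
`gaussianMatrix_exists_nearCount_ge_le` and `gaussianMatrix_bad_output_le`. The failure bound
exp(-q) carries no prefactor and q may be small, so the budget is split exactly: exp(-2q) for W₀ and
exp(-q) - exp(-2q) for V. -/

namespace TwoLayerReLU

/-! ### Gaussian linear functionals, tails and anti-concentration -/

/-- A sum of independent centred Gaussian variables on a product space is a centred Gaussian. -/
lemma map_sum_pi_eq_gaussianReal {ι : Type*} [Fintype ι] {Ω : ι → Type*}
    [∀ i, MeasurableSpace (Ω i)] (μ : ∀ i, Measure (Ω i)) [∀ i, IsProbabilityMeasure (μ i)]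
    (f : ∀ i, Ω i → ℝ) (hf : ∀ i, Measurable (f i)) (v : ι → ℝ≥0)
    (h : ∀ i, (μ i).map (f i) = gaussianReal 0 (v i)) :
    (Measure.pi μ).map (fun ω => ∑ i, f i (ω i)) = gaussianReal 0 (∑ i, v i) := by
  have hm : Measurable (fun ω : ∀ i, Ω i => ∑ i, f i (ω i)) :=
    Finset.measurable_sum _ fun i _ => (hf i).comp (measurable_pi_apply i)
  have : IsProbabilityMeasure ((Measure.pi μ).map (fun ω => ∑ i, f i (ω i))) :=
    Measure.isProbabilityMeasure_map hm.aemeasurable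
  apply Measure.ext_of_charFun
  ext t
  rw [charFun_apply_real, integral_map hm.aemeasurable (by fun_prop), charFun_gaussianReal]
  have h1 : ∀ ω : ∀ i, Ω i, Complex.exp (t * ((∑ i, f i (ω i) : ℝ) : ℂ) * Complex.I)
      = ∏ i, Complex.exp (t * (f i (ω i) : ℂ) * Complex.I) := by
    intro ω
    rw [← Complex.exp_sum]
    congr 1
    push_cast
    rw [Finset.mul_sum, Finset.sum_mul]
  simp_rw [h1]
  rw [integral_fintype_prod_eq_prod (fun i (w : Ω i) => Complex.exp (t * (f i w : ℂ) * Complex.I))]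
  have h2 : ∀ i, ∫ w, Complex.exp (t * (f i w : ℂ) * Complex.I) ∂(μ i)
      = Complex.exp (-((v i : ℂ) * t ^ 2 / 2)) := by
    intro i
    have := charFun_gaussianReal (μ := 0) (v := v i) t
    rw [← h i, charFun_apply_real, integral_map (hf i).aemeasurable (by fun_prop)] at this
    rw [this]
    congr 1
    simp
  simp_rw [h2]
  rw [← Complex.exp_sum]
  congr 1
  push_cast
  simp [Finset.sum_mul, Finset.sum_div]

/-- The inner product of a vector of independent `N(0, v)` variables with `u` is `N(0, v ‖u‖²)`. -/
lemma pi_gaussianReal_map_dot {d : ℕ} (v : ℝ≥0) (u : Fin d → ℝ) :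
    (Measure.pi fun _ : Fin d => gaussianReal 0 v).map (fun w => ∑ l, w l * u l)
      = gaussianReal 0 ((∑ l, u l ^ 2).toNNReal * v) := by
  rw [map_sum_pi_eq_gaussianReal (fun _ => gaussianReal 0 v) (fun l z => z * u l)
    (fun l => by fun_prop) (fun l => (u l ^ 2).toNNReal * v)]
  · rw [← Finset.sum_mul, Real.toNNReal_sum_of_nonneg fun l _ => sq_nonneg _]
  · intro l
    rw [gaussianReal_map_mul_const]
    congr 1
    · simp
    · congr 1
      ext
      simp [sq_nonneg]

/-- A linear functional of a Gaussian matrix is Gaussian. -/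
lemma gaussianMatrix_map_frobenius {p q : ℕ} (v : ℝ≥0) (c : Fin p → Fin q → ℝ) :
    (gaussianMatrix p q v).map (fun V => ∑ a, ∑ j, V a j * c a j)
      = gaussianReal 0 ((∑ a, ∑ j, c a j ^ 2).toNNReal * v) := by
  rw [gaussianMatrix, map_sum_pi_eq_gaussianReal _ (fun a (w : Fin q → ℝ) => ∑ j, w j * c a j)
    (fun l => by fun_prop) (fun a => (∑ j, c a j ^ 2).toNNReal * v)
    (fun a => pi_gaussianReal_map_dot v (c a))]
  rw [← Finset.sum_mul, Real.toNNReal_sum_of_nonneg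
    fun l _ => Finset.sum_nonneg fun _ _ => sq_nonneg _]

/-- The Gaussian tail bound, for any upper bound `R` of the variance. -/
lemma gaussianReal_tail {v R : ℝ≥0} (h : v ≤ R) {t : ℝ} (ht : 0 ≤ t) :
    gaussianReal 0 v {z | t ≤ z} ≤ ENNReal.ofReal (Real.exp (-t ^ 2 / (2 * R))) := by
  have hs : HasSubgaussianMGF id R (gaussianReal 0 v) := by
    refine ⟨fun t => integrable_exp_mul_gaussianReal t, fun t => ?_⟩
    rw [mgf_id_gaussianReal]
    have : (v : ℝ) ≤ R := by exact_mod_cast h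
    simp only [zero_mul, zero_add]
    gcongr
  have := hs.measure_ge_le ht
  rw [← ofReal_measureReal]
  exact ENNReal.ofReal_le_ofReal this

lemma gaussianMatrix_tail {p q : ℕ} (v : ℝ≥0) (c : Fin p → Fin q → ℝ)
    (hc : ∑ a, ∑ j, c a j ^ 2 ≤ 1) {t : ℝ} (ht : 0 ≤ t) :
    gaussianMatrix p q v {V | t ≤ ∑ a, ∑ j, V a j * c a j}
      ≤ ENNReal.ofReal (Real.exp (-t ^ 2 / (2 * v))) := by
  have hm : Measurable (fun V : Fin p → Fin q → ℝ => ∑ a, ∑ j, V a j * c a j) := by fun_prop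
  have := gaussianReal_tail (v := (∑ a, ∑ j, c a j ^ 2).toNNReal * v) (R := v)
    (by
      refine mul_le_of_le_one_left (zero_le) ?_
      rw [Real.toNNReal_le_iff_le_coe]
      simpa using hc) ht
  rw [← gaussianMatrix_map_frobenius,
    Measure.map_apply hm (s := {z | t ≤ z}) measurableSet_Ici] at this
  exact this

/-- Anti-concentration of the centred Gaussian around zero. -/
lemma gaussianReal_abs_le {v : ℝ≥0} (hv : v ≠ 0) {β : ℝ} :
    gaussianReal 0 v {z | |z| ≤ β} ≤ ENNReal.ofReal ((√(2 * Real.pi * v))⁻¹ * (2 * β)) := by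
  rw [gaussianReal_apply _ hv]
  have hset : {z : ℝ | |z| ≤ β} = Set.Icc (-β) β := by
    ext z
    simp [abs_le]
  calc ∫⁻ z in {z | |z| ≤ β}, gaussianPDF 0 v z
      ≤ ∫⁻ z in {z | |z| ≤ β}, ENNReal.ofReal ((√(2 * Real.pi * v))⁻¹) := by
        refine lintegral_mono fun z => ?_
        rw [gaussianPDF]
        refine ENNReal.ofReal_le_ofReal ?_
        rw [gaussianPDFReal]
        refine mul_le_of_le_one_right (by positivity) ?_
        rw [Real.exp_le_one_iff]
        have : 0 ≤ (z - 0) ^ 2 / (2 * v) := by positivity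
        rw [neg_div]
        linarith
    _ = _ := by
        rw [setLIntegral_const, hset, Real.volume_Icc, ← ENNReal.ofReal_mul (by positivity)]
        congr 1
        ring

/-! ### Nets and norms of Gaussian column submatrices -/

/-- The unit ball of a finite-dimensional space has a `1/2`-net with at most `5 ^ dim` points. -/
lemma exists_half_net (E : Type*) [NormedAddCommGroup E] [NormedSpace ℝ E]
    [FiniteDimensional ℝ E] :
    ∃ N : Finset E, N.card ≤ 5 ^ Module.finrank ℝ E ∧ (∀ u ∈ N, ‖u‖ ≤ 1) ∧
      ∀ v : E, ‖v‖ ≤ 1 → ∃ u ∈ N, ‖v - u‖ ≤ 1 / 2 := by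
  classical
  let P : Finset E → Prop := fun s =>
    (∀ c ∈ s, ‖c‖ ≤ 1) ∧ ∀ c ∈ s, ∀ e ∈ s, c ≠ e → 1 / 2 ≤ ‖c - e‖
  have hbound : ∀ s, P s → s.card ≤ 5 ^ Module.finrank ℝ E := by
    intro s hs
    -- Doubling turns a 1/2-separated set in the unit ball into a 1-separated set in the ball of
    -- radius 2, the normalization of `Besicovitch.card_le_of_separated`.
    have hinj : Function.Injective (fun c : E => (2 : ℝ) • c) := smul_right_injective E two_ne_zero
    rw [← Finset.card_image_of_injective s hinj]
    apply Besicovitch.card_le_of_separated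
    · intro _ hc'
      obtain ⟨c, hc, rfl⟩ := Finset.mem_image.1 hc'
      have := hs.1 c hc
      simp only [norm_smul, Real.norm_ofNat]
      linarith
    · intro _ hc' _ he' hne
      obtain ⟨c, hc, rfl⟩ := Finset.mem_image.1 hc'
      obtain ⟨e, he, rfl⟩ := Finset.mem_image.1 he'
      have := hs.2 c hc e he fun h => hne (by rw [h])
      simp only [← smul_sub, norm_smul, Real.norm_ofNat]
      linarith
  let Q : ℕ → Prop := fun n => ∃ s, P s ∧ s.card = n
  have hQ0 : Q 0 := ⟨∅, by simp [P], rfl⟩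
  obtain ⟨N, hN, hcard⟩ : Q (Nat.findGreatest Q (5 ^ Module.finrank ℝ E)) :=
    Nat.findGreatest_spec (Nat.zero_le _) hQ0
  refine ⟨N, hbound N hN, hN.1, fun v hv => ?_⟩
  -- A separated set of largest cardinality is a net: a point far from all of `N` could be added to
  -- it.
  by_contra! hfar
  have hvN : v ∉ N := fun h => by
    have := hfar v h
    norm_num at this
  have hins : P (insert v N) := by
    refine ⟨?_, ?_⟩
    · intro c hc
      rcases Finset.mem_insert.1 hc with rfl | hc
      · exact hv
      · exact hN.1 c hc
    · intro c hc' e he' hne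
      rcases Finset.mem_insert.1 hc' with rfl | hc <;> rcases Finset.mem_insert.1 he' with rfl | he
      · exact absurd rfl hne
      · exact (hfar e he).le
      · rw [norm_sub_rev]
        exact (hfar c hc).le
      · exact hN.2 c hc e he hne
  have := Nat.le_findGreatest (P := Q) (hbound _ hins) ⟨_, hins, rfl⟩
  rw [Finset.card_insert_of_notMem hvN, hcard] at this
  lia

lemma norm_le_of_half_net_inner {E : Type*} [NormedAddCommGroup E] [InnerProductSpace ℝ E]
    {N : Finset E} (hN : ∀ v : E, ‖v‖ ≤ 1 → ∃ u ∈ N, ‖v - u‖ ≤ 1 / 2) {w : E} {b : ℝ} (hb : 0 ≤ b)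
    (h : ∀ u ∈ N, inner ℝ u w ≤ b) : ‖w‖ ≤ 2 * b := by
  rcases eq_or_ne w 0 with rfl | hw
  · simpa using hb
  have hw' : 0 < ‖w‖ := norm_pos_iff.2 hw
  obtain ⟨u, hu, hd⟩ := hN (‖w‖⁻¹ • w) (by rw [norm_smul, norm_inv, norm_norm,
    inv_mul_cancel₀ hw'.ne'])
  have h1 : inner ℝ (‖w‖⁻¹ • w) w = ‖w‖ := by
    rw [real_inner_smul_left, real_inner_self_eq_norm_sq]
    field_simp
  have h2 : inner ℝ (‖w‖⁻¹ • w - u) w ≤ 1 / 2 * ‖w‖ :=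
    (real_inner_le_norm _ _).trans (by gcongr)
  rw [inner_sub_left, h1] at h2
  linarith [h u hu]

/-- Replacing a unit vector by its nearest net point costs at most ‖T‖ / 2, which is absorbed on the
left. -/
lemma opNorm_le_of_half_net {E F : Type*} [NormedAddCommGroup E] [NormedSpace ℝ E]
    [NormedAddCommGroup F] [NormedSpace ℝ F]
    {N : Finset E} (hN : ∀ v : E, ‖v‖ ≤ 1 → ∃ u ∈ N, ‖v - u‖ ≤ 1 / 2) (T : E →L[ℝ] F) {b : ℝ}
    (hb : 0 ≤ b) (h : ∀ u ∈ N, ‖T u‖ ≤ b) : ‖T‖ ≤ 2 * b := by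
  have key : ‖T‖ ≤ b + ‖T‖ / 2 := by
    refine T.opNorm_le_of_unit_norm (by positivity) fun v hv => ?_
    obtain ⟨u, hu, hd⟩ := hN v hv.le
    calc ‖T v‖ = ‖T u + T (v - u)‖ := by rw [← map_add]; congr 2; abel
      _ ≤ ‖T u‖ + ‖T (v - u)‖ := norm_add_le _ _
      _ ≤ b + ‖T‖ * (1 / 2) := by
        gcongr
        · exact h u hu
        · exact (T.le_opNorm _).trans (by gcongr)
      _ = b + ‖T‖ / 2 := by ring
  linarith

/-- The submatrix of `V` on the columns in `S` has spectral norm at most `b`. -/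
def ColumnBound {k m : ℕ} (V : Fin k → Fin m → ℝ) (S : Finset (Fin m)) (b : ℝ) : Prop :=
  ∀ (u : EuclideanSpace ℝ (Fin k)) (r : EuclideanSpace ℝ (Fin m)), (∀ j ∉ S, r j = 0) →
    ∑ a, u a * ∑ j, V a j * r j ≤ b * ‖u‖ * ‖r‖

/-- The factor 4 is 2 · 2: one net discretizes the output vector, the other the input vector
supported on `S`. -/
lemma columnBound_of_nets {k m : ℕ} (V : Fin k → Fin m → ℝ) (S : Finset (Fin m)) {b : ℝ}
    (hb : 0 ≤ b) {N : Finset (EuclideanSpace ℝ (Fin k))}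
    (hN : ∀ v : EuclideanSpace ℝ (Fin k), ‖v‖ ≤ 1 → ∃ u ∈ N, ‖v - u‖ ≤ 1 / 2)
    {N' : Finset (EuclideanSpace ℝ S)}
    (hN' : ∀ v : EuclideanSpace ℝ S, ‖v‖ ≤ 1 → ∃ u ∈ N', ‖v - u‖ ≤ 1 / 2)
    (h : ∀ u ∈ N, ∀ w ∈ N', ∑ a, u a * ∑ j : S, V a j * w j ≤ b) :
    ColumnBound V S (4 * b) := by
  let T : EuclideanSpace ℝ S →L[ℝ] EuclideanSpace ℝ (Fin k) :=
    LinearMap.toContinuousLinearMap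
      (Matrix.toEuclideanLin (Matrix.of fun a (j : S) => V a j))
  have hT : ∀ u w, inner ℝ u (T w) = ∑ a, u a * ∑ j : S, V a j * w j := by
    intro u w
    simp [T, PiLp.inner_apply, Matrix.toLpLin_apply, Matrix.mulVec, dotProduct, mul_comm]
  have hTn : ‖T‖ ≤ 4 * b := by
    have := opNorm_le_of_half_net hN' T (b := 2 * b) (by positivity) fun w hw =>
      norm_le_of_half_net_inner hN hb fun u hu => by
        rw [hT]
        exact h u hu w hw
    linarith
  intro u r hr
  let w : EuclideanSpace ℝ S := WithLp.toLp 2 fun j => r j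
  have hw : ‖w‖ = ‖r‖ := by
    rw [EuclideanSpace.norm_eq, EuclideanSpace.norm_eq]
    congr 1
    rw [← Finset.sum_subset (Finset.subset_univ S) fun j _ hj => by simp [hr j hj]]
    exact Finset.sum_coe_sort S fun j => ‖r j‖ ^ 2
  have hsum : ∀ a, ∑ j, V a j * r j = ∑ j : S, V a j * w j := by
    intro a
    rw [← Finset.sum_subset (Finset.subset_univ S) fun j _ hj => by simp [hr j hj]]
    exact (Finset.sum_coe_sort S fun j => V a j * r j).symm
  simp_rw [hsum]
  rw [← hT, ← hw]
  calc inner ℝ u (T w) ≤ ‖u‖ * ‖T w‖ := real_inner_le_norm _ _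
    _ ≤ ‖u‖ * (‖T‖ * ‖w‖) := by gcongr; exact T.le_opNorm w
    _ ≤ ‖u‖ * (4 * b * ‖w‖) := by gcongr
    _ = _ := by ring

/-- The columns in a fixed set `S` form a submatrix of large norm only with small probability. -/
lemma gaussianMatrix_not_columnBound {k m : ℕ} (v : ℝ≥0) (S : Finset (Fin m)) {b : ℝ}
    (hb : 0 ≤ b) :
    gaussianMatrix k m v {V | ¬ ColumnBound V S (4 * b)}
      ≤ ENNReal.ofReal (5 ^ (k + S.card) * Real.exp (-b ^ 2 / (2 * v))) := by
  classical
  obtain ⟨N, hcard, hN1, hN⟩ := exists_half_net (EuclideanSpace ℝ (Fin k))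
  obtain ⟨N', hcard', hN1', hN'⟩ := exists_half_net (EuclideanSpace ℝ S)
  simp only [finrank_euclideanSpace, Fintype.card_fin, Fintype.card_coe] at hcard hcard'
  let c : EuclideanSpace ℝ (Fin k) × EuclideanSpace ℝ S → Fin k → Fin m → ℝ :=
    fun p a j => p.1 a * if h : j ∈ S then p.2 ⟨j, h⟩ else 0
  have hext : ∀ (g : Fin m → ℝ) (w : EuclideanSpace ℝ S),
      ∑ j, g j * (if h : j ∈ S then w ⟨j, h⟩ else 0) = ∑ j : S, g j * w j := by
    intro g w
    rw [← Finset.sum_subset (Finset.subset_univ S) fun j _ hj => by simp [hj],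
      ← Finset.sum_coe_sort S]
    exact Finset.sum_congr rfl fun j _ => by simp
  have hc : ∀ p ∈ N ×ˢ N', ∑ a, ∑ j, c p a j ^ 2 ≤ 1 := by
    intro p hp
    rw [Finset.mem_product] at hp
    have h1 := hN1 _ hp.1
    have h2 := hN1' _ hp.2
    have e1 : ∀ a, ∑ j, c p a j ^ 2 = p.1 a ^ 2 * ‖p.2‖ ^ 2 := by
      intro a
      simp only [c, mul_pow, ← Finset.mul_sum]
      congr 1
      rw [EuclideanSpace.norm_sq_eq, ← Finset.sum_subset (Finset.subset_univ S)
        fun j _ hj => by simp [hj], ← Finset.sum_coe_sort S]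
      exact Finset.sum_congr rfl fun j _ => by simp
    simp_rw [e1]
    rw [← Finset.sum_mul]
    have e2 : ∑ a, p.1 a ^ 2 = ‖p.1‖ ^ 2 := by
      rw [EuclideanSpace.norm_sq_eq]
      simp
    rw [e2]
    exact mul_le_one₀ (pow_le_one₀ (norm_nonneg _) h1) (by positivity)
      (pow_le_one₀ (norm_nonneg _) h2)
  have hsub : {V | ¬ ColumnBound V S (4 * b)}
      ⊆ ⋃ p ∈ N ×ˢ N', {V | b ≤ ∑ a, ∑ j, V a j * c p a j} := by
    intro V hV
    by_contra hcon
    simp only [Set.mem_iUnion, Set.mem_ofPred_eq, not_exists, not_le] at hcon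
    refine hV (columnBound_of_nets V S hb hN hN' fun u hu w hw => ?_)
    have := hcon (u, w) (Finset.mem_product.2 ⟨hu, hw⟩)
    refine le_of_eq_of_le (Finset.sum_congr rfl fun a _ => ?_) this.le
    rw [← hext, Finset.mul_sum]
    exact Finset.sum_congr rfl fun j _ => by simp only [c]; ring
  calc gaussianMatrix k m v {V | ¬ ColumnBound V S (4 * b)}
      ≤ ∑ p ∈ N ×ˢ N', gaussianMatrix k m v {V | b ≤ ∑ a, ∑ j, V a j * c p a j} :=
        (measure_mono hsub).trans (measure_biUnion_finset_le _ _)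
    _ ≤ ∑ p ∈ N ×ˢ N', ENNReal.ofReal (Real.exp (-b ^ 2 / (2 * v))) :=
        Finset.sum_le_sum fun p hp => gaussianMatrix_tail v (c p) (hc p hp) hb
    _ ≤ _ := by
        rw [Finset.sum_const, nsmul_eq_mul, ENNReal.ofReal_mul (by positivity)]
        gcongr
        rw [ENNReal.ofReal_pow (by norm_num), Finset.card_product, pow_add]
        have : N.card * N'.card ≤ 5 ^ k * 5 ^ S.card := Nat.mul_le_mul hcard hcard'
        simpa using (Nat.cast_le (α := ℝ≥0∞)).2 this

/-- A nonempty set of at most `s` columns is the range of some map `Fin s → Fin m`, so a union bound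
over `m ^ s` maps covers all sizes up to `s` at once. -/
lemma gaussianMatrix_not_columnBound_card_le {k m : ℕ} (v : ℝ≥0) (s : ℕ) {b : ℝ} (hb : 0 ≤ b) :
    gaussianMatrix k m v
        {V | ∃ S : Finset (Fin m), S.Nonempty ∧ S.card ≤ s ∧ ¬ ColumnBound V S (4 * b)}
      ≤ ENNReal.ofReal (m ^ s * (5 ^ (k + s) * Real.exp (-b ^ 2 / (2 * v)))) := by
  classical
  have hsub : {V : Fin k → Fin m → ℝ | ∃ S : Finset (Fin m), S.Nonempty ∧ S.card ≤ s ∧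
        ¬ ColumnBound V S (4 * b)}
      ⊆ ⋃ f ∈ (Finset.univ : Finset (Fin s → Fin m)),
        {V | ¬ ColumnBound V (Finset.univ.image f) (4 * b)} := by
    rintro V ⟨S, hne, hcard, hV⟩
    have : Nonempty S := hne.to_subtype
    obtain ⟨e⟩ : Nonempty (S ↪ Fin s) := by
      rw [Function.Embedding.nonempty_iff_card_le]
      simpa using hcard
    have hS : Finset.univ.image (fun i => ((Function.invFun e i : S) : Fin m)) = S := by
      ext j
      simp only [Finset.mem_image, Finset.mem_univ, true_and]
      constructor
      · rintro ⟨i, rfl⟩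
        exact (Function.invFun e i).2
      · intro hj
        exact ⟨e ⟨j, hj⟩, by rw [Function.leftInverse_invFun e.injective]⟩
    simp only [Set.mem_iUnion, Finset.mem_univ, exists_prop, true_and]
    exact ⟨fun i => ((Function.invFun e i : S) : Fin m), by
      show ¬ _
      rwa [hS]⟩
  calc _ ≤ ∑ f : Fin s → Fin m, gaussianMatrix k m v
            {V | ¬ ColumnBound V (Finset.univ.image f) (4 * b)} :=
        (measure_mono hsub).trans (measure_biUnion_finset_le _ _)
    _ ≤ ∑ f : Fin s → Fin m, ENNReal.ofReal (5 ^ (k + s) * Real.exp (-b ^ 2 / (2 * v))) := by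
        refine Finset.sum_le_sum fun f _ =>
          (gaussianMatrix_not_columnBound v _ hb).trans (ENNReal.ofReal_le_ofReal ?_)
        gcongr
        · norm_num
        · exact Finset.card_image_le.trans (by simp)
    _ = _ := by
        rw [Finset.sum_const, nsmul_eq_mul, ENNReal.ofReal_mul (by positivity)]
        simp [ENNReal.ofReal_pow]

/-! ### Counting rows nearly orthogonal to a sample -/

/-- A Chernoff bound for the number of coordinates of an i.i.d. family that fall into `E`. -/
lemma pi_card_ge_le {Ω : Type*} [MeasurableSpace Ω] (μ : Measure Ω) [IsProbabilityMeasure μ]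
    {E : Set Ω} [DecidablePred (· ∈ E)] (hE : MeasurableSet E) {p : ℝ} (hp : 0 ≤ p)
    (h : μ E ≤ ENNReal.ofReal p) (m : ℕ) (t : ℝ) :
    Measure.pi (fun _ : Fin m => μ)
        {ω | t ≤ ((Finset.univ.filter fun j => ω j ∈ E).card : ℝ)}
      ≤ ENNReal.ofReal (Real.exp (2 * (m * p) - t)) := by
  let g : Ω → ℝ := E.indicator 1
  have hg : Measurable g := measurable_one.indicator hE
  have hg1 : ∀ w, g w ≤ 1 := fun w => Set.indicator_le_self' (by simp) w
  have hcard : ∀ ω : Fin m → Ω, ((Finset.univ.filter fun j => ω j ∈ E).card : ℝ)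
      = ∑ j, g (ω j) := by
    intro ω
    simp [g, Set.indicator_apply]
  let X : (Fin m → Ω) → ℝ := fun ω => ∑ j, g (ω j)
  have hX : Measurable X := by fun_prop
  have hint : Integrable (fun ω => Real.exp (1 * X ω)) (Measure.pi fun _ : Fin m => μ) := by
    refine Integrable.of_bound (by fun_prop) (Real.exp m) (ae_of_all _ fun ω => ?_)
    rw [Real.norm_eq_abs, Real.abs_exp, one_mul]
    gcongr
    calc X ω ≤ ∑ j : Fin m, (1 : ℝ) := Finset.sum_le_sum fun j _ => hg1 _
      _ = m := by simp
  -- The exponential moment at parameter 1 of an indicator is 1 + (e - 1) μ(E), at most 1 + 2p and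
  -- so at most exp(2p).
  have hone : ∫ w, Real.exp (g w) ∂μ ≤ Real.exp (2 * p) := by
    have e : ∀ w, Real.exp (g w) = 1 + (Real.exp 1 - 1) * g w := by
      intro w
      by_cases hw : w ∈ E <;> simp [g, hw]
    have hgi : Integrable g μ := (integrable_const (1 : ℝ)).indicator hE
    have hgE : ∫ w, g w ∂μ ≤ p := by
      rw [integral_indicator_one hE]
      exact ENNReal.toReal_le_of_le_ofReal hp h
    simp_rw [e]
    rw [integral_add (integrable_const _) (hgi.const_mul _), integral_const_mul]
    have h1 : Real.exp 1 - 1 ≤ 2 := by linarith [Real.exp_one_lt_d9]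
    have h2 : 0 ≤ ∫ w, g w ∂μ := integral_nonneg fun w => Set.indicator_nonneg (by simp) w
    have h3 := Real.add_one_le_exp (2 * p)
    simp only [integral_const, probReal_univ, smul_eq_mul, mul_one]
    nlinarith
  have hmgf : mgf X (Measure.pi fun _ : Fin m => μ) 1 ≤ Real.exp (2 * (m * p)) := by
    have e : ∀ ω : Fin m → Ω, Real.exp (1 * X ω) = ∏ j, Real.exp (g (ω j)) := by
      intro ω
      rw [← Real.exp_sum, one_mul]
    rw [mgf]
    simp_rw [e]
    rw [integral_fintype_prod_eq_prod (fun (_ : Fin m) w => Real.exp (g w)), Finset.prod_const]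
    calc _ ≤ Real.exp (2 * p) ^ (Finset.univ : Finset (Fin m)).card :=
          pow_le_pow_left₀ (integral_nonneg fun w => (Real.exp_pos _).le) hone _
      _ = _ := by
          rw [← Real.exp_nat_mul]
          congr 1
          simp
          ring
  have := measure_ge_le_exp_mul_mgf (μ := Measure.pi fun _ : Fin m => μ) t zero_le_one hint
  simp_rw [hcard]
  rw [← ofReal_measureReal]
  refine ENNReal.ofReal_le_ofReal (this.trans ?_)
  rw [sub_eq_neg_add, Real.exp_add, neg_one_mul]
  exact mul_le_mul_of_nonneg_left hmgf (Real.exp_pos _).le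

lemma pi_gaussianReal_abs_dot_le {m d : ℕ} (hm : 0 < m) (x : EuclideanSpace ℝ (Fin d))
    (hx : ‖x‖ = 1) {β : ℝ} (hβ : 0 ≤ β) :
    (Measure.pi fun _ : Fin d => gaussianReal 0 (2 / (m : ℝ≥0)))
        {w | |∑ l, w l * x l| ≤ β} ≤ ENNReal.ofReal (β * √m) := by
  have hsum : ∑ l, x l ^ 2 = 1 := by
    have := EuclideanSpace.norm_sq_eq x
    rw [hx] at this
    simpa using this.symm
  have hm' : (0 : ℝ) < m := by exact_mod_cast hm
  have hv : (2 / (m : ℝ≥0)) ≠ 0 := by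
    have : (m : ℝ≥0) ≠ 0 := by exact_mod_cast hm.ne'
    positivity
  have hmeas : Measurable fun w : Fin d → ℝ => ∑ l, w l * x l := by fun_prop
  have hset : MeasurableSet {z : ℝ | |z| ≤ β} := measurableSet_le (by fun_prop) (by fun_prop)
  have h := gaussianReal_abs_le hv (β := β)
  have hmap := pi_gaussianReal_map_dot (2 / (m : ℝ≥0)) x
  rw [hsum, Real.toNNReal_one, one_mul] at hmap
  rw [← hmap, Measure.map_apply hmeas hset] at h
  refine h.trans (ENNReal.ofReal_le_ofReal ?_)
  -- The variance 2 / m gives a density of at most √m / √(4π), hence at most √m / 2, on an interval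
  -- of length 2β.
  have h1 : (2 / √m) ≤ √(2 * Real.pi * (2 / (m : ℝ≥0) : ℝ≥0)) := by
    apply Real.le_sqrt_of_sq_le
    rw [div_pow, Real.sq_sqrt hm'.le]
    push_cast
    have : 2 * Real.pi * (2 / (m : ℝ)) = (4 * Real.pi) / m := by ring
    rw [this]
    gcongr
    nlinarith [Real.pi_gt_three]
  have hs : 0 < √(m : ℝ) := Real.sqrt_pos.2 hm'
  calc _ ≤ (2 / √m)⁻¹ * (2 * β) := by gcongr
    _ = _ := by
      rw [inv_div]
      ring

/-- The number of rows of `W` that are nearly orthogonal to `x`. -/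
noncomputable def nearCount {m d : ℕ} (W : Fin m → Fin d → ℝ) (x : EuclideanSpace ℝ (Fin d))
    (β : ℝ) : ℕ :=
  open Classical in (Finset.univ.filter fun j => |∑ l, W j l * x l| ≤ β).card

lemma gaussianMatrix_nearCount_ge_le {m d : ℕ} (hm : 0 < m) (x : EuclideanSpace ℝ (Fin d))
    (hx : ‖x‖ = 1) {β : ℝ} (hβ : 0 ≤ β) (t : ℝ) :
    gaussianMatrix m d (2 / (m : ℝ≥0)) {W | t ≤ nearCount W x β}
      ≤ ENNReal.ofReal (Real.exp (2 * (m * (β * √m)) - t)) := by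
  classical
  have hE : MeasurableSet {w : Fin d → ℝ | |∑ l, w l * x l| ≤ β} :=
    measurableSet_le (by fun_prop) (by fun_prop)
  have := pi_card_ge_le (Measure.pi fun _ : Fin d => gaussianReal 0 (2 / (m : ℝ≥0))) hE
    (by positivity) (pi_gaussianReal_abs_dot_le hm x hx hβ) m t
  refine (measure_mono fun W hW => ?_).trans this
  have hW' : t ≤ nearCount W x β := hW
  unfold nearCount at hW'
  show t ≤ _
  convert hW'
  exact Iff.rfl

lemma gaussianMatrix_exists_nearCount_ge_le {n m d : ℕ} (hn : 0 < n) (hm : 0 < m)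
    (x : Fin n → EuclideanSpace ℝ (Fin d)) (hx : ∀ i, ‖x i‖ = 1) {β : ℝ} (hβ : 0 ≤ β) (t : ℝ) :
    gaussianMatrix m d (2 / (m : ℝ≥0)) {W | ∃ i, t ≤ nearCount W (x i) β}
      ≤ ENNReal.ofReal (Real.exp (Real.log n + 2 * (m * (β * √m)) - t)) := by
  have hn' : (0 : ℝ) < n := by exact_mod_cast hn
  have hsub : {W : Fin m → Fin d → ℝ | ∃ i, t ≤ nearCount W (x i) β}
      ⊆ ⋃ i ∈ (Finset.univ : Finset (Fin n)), {W | t ≤ nearCount W (x i) β} := by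
    rintro W ⟨i, hi⟩
    simp only [Set.mem_iUnion]
    exact ⟨i, Finset.mem_univ i, hi⟩
  calc _ ≤ ∑ i, gaussianMatrix m d (2 / (m : ℝ≥0)) {W | t ≤ nearCount W (x i) β} :=
        (measure_mono hsub).trans (measure_biUnion_finset_le _ _)
    _ ≤ ∑ _i : Fin n, ENNReal.ofReal (Real.exp (2 * (m * (β * √m)) - t)) :=
        Finset.sum_le_sum fun i _ => gaussianMatrix_nearCount_ge_le hm (x i) (hx i) hβ t
    _ = _ := by
        rw [Finset.sum_const, nsmul_eq_mul, add_sub_assoc, Real.exp_add, Real.exp_log hn',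
          ENNReal.ofReal_mul hn'.le]
        simp

/-! ### ReLU remainders and sparsity of activation changes -/

/-- The remainder of the first-order expansion of the rectified linear unit at `a`. -/
noncomputable def reluRem (s a b : ℝ) : ℝ := relu b - relu a - reluDeriv s a * (b - a)

lemma abs_relu_sub_relu_le (a b : ℝ) : |relu b - relu a| ≤ |b - a| := by
  unfold relu
  exact abs_max_sub_max_le_abs b a 0

/-- The secant slope and the chosen derivative both lie in [0, 1], so they differ by at most 1. -/
lemma abs_reluRem_le {s : ℝ} (hs : s ∈ Set.Icc (0 : ℝ) 1) (a b : ℝ) :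
    |reluRem s a b| ≤ |b - a| := by
  obtain ⟨h0, h1⟩ := hs
  unfold reluRem reluDeriv relu
  rcases lt_trichotomy a 0 with ha | rfl | ha
  · rw [if_neg ha.not_gt, if_pos ha, max_eq_right ha.le]
    rcases le_total b 0 with hb | hb
    · simp [hb]
    · rw [max_eq_left hb, abs_of_nonneg (by linarith), abs_of_nonneg (by linarith)]
      linarith
  · simp only [lt_self_iff_false, if_false, max_self, sub_zero]
    rcases le_total b 0 with hb | hb
    · rw [max_eq_right hb, abs_of_nonneg (by nlinarith), abs_of_nonpos hb]
      nlinarith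
    · rw [max_eq_left hb, abs_of_nonneg (by nlinarith), abs_of_nonneg hb]
      nlinarith
  · rw [if_pos ha, max_eq_left ha.le]
    rcases le_total b 0 with hb | hb
    · rw [max_eq_right hb, abs_of_nonneg (by linarith), abs_of_nonpos (by linarith)]
      linarith
    · simp [hb]

/-- The remainder vanishes unless a perturbation of size `|c|` has moved `a` or `b` from `c`. -/
lemma abs_le_of_reluRem_ne_zero {s a b : ℝ} (h : reluRem s a b ≠ 0) (c : ℝ) :
    |c| ≤ |a - c| ∨ |c| ≤ |b - c| := by
  -- Otherwise `a` and `b` lie strictly on the same side of zero as `c`, where ReLU is linear; the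
  -- value `s` at zero plays no role.
  by_contra! hcon
  obtain ⟨h1, h2⟩ := hcon
  apply h
  unfold reluRem reluDeriv relu
  rcases le_total c 0 with hc | hc
  · rw [abs_of_nonpos hc, abs_lt] at h1 h2
    have ha : a < 0 := by linarith
    have hb : b < 0 := by linarith
    simp [ha, ha.not_gt, ha.le, hb.le]
  · rw [abs_of_nonneg hc, abs_lt] at h1 h2
    have ha : 0 < a := by linarith
    have hb : 0 < b := by linarith
    simp [ha, ha.le, hb.le]

lemma norm_mulVec_le {m d : ℕ} (A : Matrix (Fin m) (Fin d) ℝ) (x : EuclideanSpace ℝ (Fin d)) :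
    ‖(WithLp.toLp 2 (A *ᵥ x.ofLp) : EuclideanSpace ℝ (Fin m))‖ ≤ specNorm A * ‖x‖ :=
  (LinearMap.toContinuousLinearMap (Matrix.toEuclideanLin A)).le_opNorm x

lemma abs_mulVec_apply_le {m d : ℕ} (A : Matrix (Fin m) (Fin d) ℝ)
    (x : EuclideanSpace ℝ (Fin d)) (j : Fin m) :
    |(A *ᵥ x.ofLp) j| ≤ twoInftyNorm A * ‖x‖ := by
  have h1 : (A *ᵥ x.ofLp) j = inner ℝ (WithLp.toLp 2 (A j) : EuclideanSpace ℝ (Fin d)) x := by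
    simp [PiLp.inner_apply, Matrix.mulVec, dotProduct, mul_comm]
  rw [h1]
  refine (abs_real_inner_le_norm _ _).trans ?_
  gcongr
  exact le_ciSup (f := fun j => ‖(WithLp.toLp 2 (A j) : EuclideanSpace ℝ (Fin d))‖)
    (Set.finite_range _).bddAbove j

lemma card_filter_lt_abs_le {ι : Type*} [Fintype ι] (z : EuclideanSpace ℝ ι) {β T : ℝ}
    (hβ : 0 < β) (hz : ‖z‖ ≤ T) :
    ((Finset.univ.filter fun j => β < |z j|).card : ℝ) ≤ T ^ 2 / β ^ 2 := by
  rw [le_div_iff₀ (by positivity)]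
  calc ((Finset.univ.filter fun j => β < |z j|).card : ℝ) * β ^ 2
      = ∑ j ∈ Finset.univ.filter fun j => β < |z j|, β ^ 2 := by
        rw [Finset.sum_const, nsmul_eq_mul]
    _ ≤ ∑ j ∈ Finset.univ.filter fun j => β < |z j|, ‖z j‖ ^ 2 := by
        refine Finset.sum_le_sum fun j hj => ?_
        rw [Real.norm_eq_abs]
        exact pow_le_pow_left₀ hβ.le (Finset.mem_filter.1 hj).2.le 2
    _ ≤ ∑ j, ‖z j‖ ^ 2 :=
        Finset.sum_le_sum_of_subset_of_nonneg (Finset.filter_subset _ _)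
          fun _ _ _ => by positivity
    _ = ‖z‖ ^ 2 := (EuclideanSpace.norm_sq_eq z).symm
    _ ≤ T ^ 2 := by gcongr

/-- Few neurons change their activation pattern within the perturbation region. -/
lemma card_reluRem_ne_zero_le {m d : ℕ} (s : ℝ) {W₀ W W' : Matrix (Fin m) (Fin d) ℝ} {τ β : ℝ}
    (hβ : 0 < β) (hW : W ∈ specBall W₀ τ) (hW' : W' ∈ specBall W₀ τ)
    (x : EuclideanSpace ℝ (Fin d)) (hx : ‖x‖ = 1) :
    ((Finset.univ.filter fun j =>
        reluRem s ((W *ᵥ x.ofLp) j) ((W' *ᵥ x.ofLp) j) ≠ 0).card : ℝ)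
      ≤ nearCount W₀ x β + 2 * (τ ^ 2 / β ^ 2) := by
  classical
  let z : Matrix (Fin m) (Fin d) ℝ → EuclideanSpace ℝ (Fin m) :=
    fun U => WithLp.toLp 2 ((U - W₀) *ᵥ x.ofLp)
  have hz : ∀ U ∈ specBall W₀ τ, ‖z U‖ ≤ τ := fun U hU =>
    (norm_mulVec_le _ x).trans (by rw [hx, mul_one]; exact hU)
  have hzj : ∀ U j, z U j = (U *ᵥ x.ofLp) j - (W₀ *ᵥ x.ofLp) j := by
    intro U j
    simp [z, Matrix.sub_mulVec]
  have h1 := card_filter_lt_abs_le (z W) hβ (hz W hW)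
  have h2 := card_filter_lt_abs_le (z W') hβ (hz W' hW')
  have hsub : (Finset.univ.filter fun j =>
        reluRem s ((W *ᵥ x.ofLp) j) ((W' *ᵥ x.ofLp) j) ≠ 0)
      ⊆ (Finset.univ.filter fun j => |∑ l, W₀ j l * x l| ≤ β)
        ∪ ((Finset.univ.filter fun j => β < |z W j|)
          ∪ (Finset.univ.filter fun j => β < |z W' j|)) := by
    intro j hj
    have hj := (Finset.mem_filter.1 hj).2
    simp only [Finset.mem_union, Finset.mem_filter, Finset.mem_univ, true_and, hzj]
    rcases le_or_gt |∑ l, W₀ j l * x l| β with h | h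
    · exact Or.inl h
    · right
      -- The comparison point is the preactivation at W₀, which exceeds β in size here.
      exact (abs_le_of_reluRem_ne_zero hj ((W₀ *ᵥ x.ofLp) j)).imp h.trans_le h.trans_le
  have h3 := (Finset.card_le_card hsub).trans ((Finset.card_union_le _ _).trans
    (Nat.add_le_add_left (Finset.card_union_le _ _) _))
  have h4 : (Finset.univ.filter fun j => |∑ l, W₀ j l * x l| ≤ β).card = nearCount W₀ x β := by
    unfold nearCount
    convert rfl
  rw [h4] at h3
  have h5 := (Nat.cast_le (α := ℝ)).2 h3
  push_cast at h5
  linarith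

/-! ### The deterministic semi-smoothness inequality -/

lemma norm_le_of_columnBound_univ {k m : ℕ} {V : Matrix (Fin k) (Fin m) ℝ} {b : ℝ}
    (h : ColumnBound V Finset.univ b) (hb : 0 ≤ b) (r : EuclideanSpace ℝ (Fin m)) :
    ‖(WithLp.toLp 2 (V *ᵥ r.ofLp) : EuclideanSpace ℝ (Fin k))‖ ≤ b * ‖r‖ := by
  set z : EuclideanSpace ℝ (Fin k) := WithLp.toLp 2 (V *ᵥ r.ofLp)
  have h1 := h z r (by simp)
  have h2 : ∑ a, z a * ∑ j, V a j * r j = ‖z‖ ^ 2 := by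
    rw [EuclideanSpace.norm_sq_eq]
    refine Finset.sum_congr rfl fun a _ => ?_
    rw [Real.norm_eq_abs, sq_abs, sq]
    rfl
  rw [h2] at h1
  rcases (norm_nonneg z).eq_or_lt with h0 | h0
  · rw [← h0]
    positivity
  · nlinarith

/-- The semi-smoothness inequality for a single sample. -/
lemma sqLoss_network_le {k m d : ℕ} {s : ℝ} (hs : s ∈ Set.Icc (0 : ℝ) 1)
    {V : Matrix (Fin k) (Fin m) ℝ} {W W' : Matrix (Fin m) (Fin d) ℝ} {b₀ b₁ K : ℝ} (hb₀ : 0 ≤ b₀)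
    (hb₁ : 0 ≤ b₁) (h₀ : ColumnBound V Finset.univ b₀)
    (h₁ : ∀ S : Finset (Fin m), S.Nonempty → (S.card : ℝ) ≤ K → ColumnBound V S b₁)
    (x : EuclideanSpace ℝ (Fin d)) (hx : ‖x‖ = 1)
    (hK : ((Finset.univ.filter fun j =>
        reluRem s ((W *ᵥ x.ofLp) j) ((W' *ᵥ x.ofLp) j) ≠ 0).card : ℝ) ≤ K)
    (y : EuclideanSpace ℝ (Fin k)) :
    sqLoss (network V W' x) y ≤ sqLoss (network V W x) y
      + ∑ a, (network V W x - y) a *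
          ∑ j, V a j * (reluDeriv s ((W *ᵥ x.ofLp) j) * ((W' - W) *ᵥ x.ofLp) j)
      + ‖network V W x - y‖ * (b₁ * √K * twoInftyNorm (W' - W))
      + b₀ ^ 2 / 2 * specNorm (W' - W) ^ 2 := by
  set e := network V W x - y with he
  let ρ : EuclideanSpace ℝ (Fin m) :=
    WithLp.toLp 2 fun j => relu ((W' *ᵥ x.ofLp) j) - relu ((W *ᵥ x.ofLp) j)
  let r : EuclideanSpace ℝ (Fin m) :=
    WithLp.toLp 2 fun j => reluRem s ((W *ᵥ x.ofLp) j) ((W' *ᵥ x.ofLp) j)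
  let δ : EuclideanSpace ℝ (Fin m) := WithLp.toLp 2 ((W' - W) *ᵥ x.ofLp)
  let z : EuclideanSpace ℝ (Fin k) := WithLp.toLp 2 (V *ᵥ ρ.ofLp)
  have hδj : ∀ j, δ j = (W' *ᵥ x.ofLp) j - (W *ᵥ x.ofLp) j := by
    intro j
    simp [δ, Matrix.sub_mulVec]
  have hnet : network V W' x - y = e + z := by
    ext a
    simp only [he, z, ρ, network, PiLp.sub_apply, PiLp.add_apply, Matrix.mulVec, dotProduct,
      mul_sub, Finset.sum_sub_distrib]
    ring
  have hδ : ‖δ‖ ≤ specNorm (W' - W) := by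
    have := norm_mulVec_le (W' - W) x
    rwa [hx, mul_one] at this
  have hρ : ‖ρ‖ ≤ ‖δ‖ := by
    rw [EuclideanSpace.norm_eq, EuclideanSpace.norm_eq]
    gcongr with j
    rw [hδj]
    exact abs_relu_sub_relu_le _ _
  have hz : ‖z‖ ≤ b₀ * specNorm (W' - W) :=
    (norm_le_of_columnBound_univ h₀ hb₀ ρ).trans (by gcongr; exact hρ.trans hδ)
  have hT : 0 ≤ twoInftyNorm (W' - W) := Real.iSup_nonneg fun _ => norm_nonneg _
  have hK0 : 0 ≤ K := (Nat.cast_nonneg _).trans hK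
  -- The activation increment ρ is its linearization plus the sparse remainder r.
  have hinner : inner ℝ e z = ∑ a, e a * ∑ j, V a j *
        (reluDeriv s ((W *ᵥ x.ofLp) j) * ((W' - W) *ᵥ x.ofLp) j)
      + ∑ a, e a * ∑ j, V a j * r j := by
    rw [← Finset.sum_add_distrib, PiLp.inner_apply]
    refine Finset.sum_congr rfl fun a _ => ?_
    rw [← mul_add, ← Finset.sum_add_distrib]
    simp only [RCLike.inner_apply, conj_trivial]
    rw [mul_comm]
    congr 1
    show ∑ j, V a j * ρ j = _
    refine Finset.sum_congr rfl fun j _ => ?_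
    have : ((W' - W) *ᵥ x.ofLp) j = (W' *ᵥ x.ofLp) j - (W *ᵥ x.ofLp) j := hδj j
    simp only [ρ, r, reluRem, this]
    ring
  have hr : ∑ a, e a * ∑ j, V a j * r j ≤ ‖e‖ * (b₁ * √K * twoInftyNorm (W' - W)) := by
    set S := Finset.univ.filter fun j =>
      reluRem s ((W *ᵥ x.ofLp) j) ((W' *ᵥ x.ofLp) j) ≠ 0 with hS
    have hr0 : ∀ j ∉ S, r j = 0 := by
      intro j hj
      simpa [hS] using hj
    -- The empty support is treated apart because `h₁` covers nonempty column sets only.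
    rcases S.eq_empty_or_nonempty with h | h
    · have : ∀ j, r j = 0 := fun j => hr0 j (by simp [h])
      simp only [this, mul_zero, Finset.sum_const_zero]
      positivity
    · have hrn : ‖r‖ ≤ √K * twoInftyNorm (W' - W) := by
        rw [EuclideanSpace.norm_eq]
        apply Real.sqrt_le_iff.2 ⟨by positivity, ?_⟩
        rw [mul_pow, Real.sq_sqrt hK0,
          ← Finset.sum_subset (Finset.subset_univ S) fun j _ hj => by simp [hr0 j hj]]
        calc ∑ j ∈ S, ‖r j‖ ^ 2 ≤ ∑ j ∈ S, twoInftyNorm (W' - W) ^ 2 := by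
              refine Finset.sum_le_sum fun j _ => ?_
              gcongr
              have h1 := abs_mulVec_apply_le (W' - W) x j
              rw [hx, mul_one] at h1
              refine (abs_reluRem_le hs _ _).trans ?_
              rw [← hδj]
              exact h1
          _ = S.card * twoInftyNorm (W' - W) ^ 2 := by
              rw [Finset.sum_const, nsmul_eq_mul]
          _ ≤ _ := by gcongr
      calc _ ≤ b₁ * ‖e‖ * ‖r‖ := h₁ S h hK e r hr0
        _ ≤ b₁ * ‖e‖ * (√K * twoInftyNorm (W' - W)) := by gcongr
        _ = _ := by ring
  unfold sqLoss
  rw [hnet, norm_add_sq_real, hinner, ← he]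
  have hz2 : ‖z‖ ^ 2 ≤ b₀ ^ 2 * specNorm (W' - W) ^ 2 := by
    rw [← mul_pow]
    gcongr
  linarith

lemma frobInner_gradLoss {n m d k : ℕ} (s : ℝ) (x : Fin n → EuclideanSpace ℝ (Fin d))
    (y : Fin n → EuclideanSpace ℝ (Fin k)) (V : Matrix (Fin k) (Fin m) ℝ)
    (W D : Matrix (Fin m) (Fin d) ℝ) :
    frobInner (gradLoss s x y V W) D = (1 / (n : ℝ)) * ∑ i, ∑ a, (network V W (x i) - y i) a *
      ∑ j, V a j * (reluDeriv s ((W *ᵥ (x i).ofLp) j) * (D *ᵥ (x i).ofLp) j) := by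
  have h1 : ∀ j l, gradLoss s x y V W j l = (1 / (n : ℝ)) * ∑ i,
      (∑ a, (network V W (x i) - y i) a * (V a j * reluDeriv s ((W *ᵥ (x i).ofLp) j)))
        * x i l := by
    intro j l
    simp only [gradLoss, activation, Matrix.smul_apply, Matrix.sum_apply, Matrix.vecMulVec_apply,
      smul_eq_mul, Matrix.vecMul, dotProduct, Matrix.mul_diagonal]
  have h2 : ∀ i, ∑ a, (network V W (x i) - y i) a *
      ∑ j, V a j * (reluDeriv s ((W *ᵥ (x i).ofLp) j) * (D *ᵥ (x i).ofLp) j)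
      = ∑ j, ∑ l, (∑ a, (network V W (x i) - y i) a *
          (V a j * reluDeriv s ((W *ᵥ (x i).ofLp) j))) * x i l * D j l := by
    intro i
    simp only [Finset.mul_sum _ _ ((network V W (x i) - y i) _)]
    rw [Finset.sum_comm]
    refine Finset.sum_congr rfl fun j _ => ?_
    have hD : (D *ᵥ (x i).ofLp) j = ∑ l, x i l * D j l := by
      rw [Matrix.mulVec, dotProduct]
      exact Finset.sum_congr rfl fun l _ => mul_comm _ _
    simp only [mul_assoc]
    rw [← Finset.mul_sum, Finset.sum_mul, hD]
    exact Finset.sum_congr rfl fun a _ => by ring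
  simp only [frobInner, h1, h2]
  rw [Finset.sum_comm (s := (Finset.univ : Finset (Fin n))), Finset.mul_sum]
  refine Finset.sum_congr rfl fun j _ => ?_
  rw [Finset.sum_comm (s := (Finset.univ : Finset (Fin n))), Finset.mul_sum]
  refine Finset.sum_congr rfl fun l _ => ?_
  rw [mul_assoc, Finset.sum_mul]

/-- Cauchy–Schwarz over the samples; √2 compensates for the 1/2 in the square loss. -/
lemma mean_norm_le_sqrt_trainLoss {n m d k : ℕ} (hn : 0 < n)
    (x : Fin n → EuclideanSpace ℝ (Fin d)) (y : Fin n → EuclideanSpace ℝ (Fin k))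
    (V : Matrix (Fin k) (Fin m) ℝ) (W : Matrix (Fin m) (Fin d) ℝ) :
    (1 / (n : ℝ)) * ∑ i, ‖network V W (x i) - y i‖ ≤ √2 * √(trainLoss x y V W) := by
  have hn' : (0 : ℝ) < n := by exact_mod_cast hn
  rw [← Real.sqrt_mul (by norm_num)]
  apply Real.le_sqrt_of_sq_le
  have h := sq_sum_le_card_mul_sum_sq (s := Finset.univ)
    (f := fun i => ‖network V W (x i) - y i‖)
  simp only [Finset.card_univ, Fintype.card_fin] at h
  unfold trainLoss sqLoss
  rw [← Finset.sum_div]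
  calc ((1 / (n : ℝ)) * ∑ i, ‖network V W (x i) - y i‖) ^ 2
      = (1 / (n : ℝ)) ^ 2 * (∑ i, ‖network V W (x i) - y i‖) ^ 2 := by ring
    _ ≤ (1 / (n : ℝ)) ^ 2 * (n * ∑ i, ‖network V W (x i) - y i‖ ^ 2) := by gcongr
    _ = _ := by field_simp

lemma semiSmooth_of_columnBound {n m d k : ℕ} (hn : 0 < n) {s : ℝ} (hs : s ∈ Set.Icc (0 : ℝ) 1)
    {V : Matrix (Fin k) (Fin m) ℝ} {W₀ W W' : Matrix (Fin m) (Fin d) ℝ} {τ β b₀ b₁ K C₁ C₂ : ℝ}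
    (x : Fin n → EuclideanSpace ℝ (Fin d)) (hx : ∀ i, ‖x i‖ = 1)
    (y : Fin n → EuclideanSpace ℝ (Fin k)) (hβ : 0 < β) (hb₀ : 0 ≤ b₀) (hb₁ : 0 ≤ b₁)
    (h₀ : ColumnBound V Finset.univ b₀)
    (h₁ : ∀ S : Finset (Fin m), S.Nonempty → (S.card : ℝ) ≤ K → ColumnBound V S b₁)
    (hK : ∀ i, nearCount W₀ (x i) β + 2 * (τ ^ 2 / β ^ 2) ≤ K)
    (hC₁ : √2 * (b₁ * √K) ≤ C₁ * (τ ^ (2 / 3 : ℝ) * m * √(Real.log m) / √(k : ℝ)))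
    (hC₂ : b₀ ^ 2 / 2 ≤ C₂ * m / k)
    (hW : W ∈ specBall W₀ τ) (hW' : W' ∈ specBall W₀ τ) :
    SemiSmooth C₁ C₂ s τ x y V W' W := by
  have hn' : (0 : ℝ) < n := by exact_mod_cast hn
  have hT : 0 ≤ twoInftyNorm (W' - W) := Real.iSup_nonneg fun _ => norm_nonneg _
  have hmean := mean_norm_le_sqrt_trainLoss hn x y V W
  set L := trainLoss x y V W with hL
  have hsum : trainLoss x y V W' ≤ L + frobInner (gradLoss s x y V W) (W' - W)
      + ((1 / (n : ℝ)) * ∑ i, ‖network V W (x i) - y i‖) * (b₁ * √K * twoInftyNorm (W' - W))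
      + b₀ ^ 2 / 2 * specNorm (W' - W) ^ 2 := by
    rw [frobInner_gradLoss]
    calc trainLoss x y V W' ≤ (1 / (n : ℝ)) * ∑ i, (sqLoss (network V W (x i)) (y i)
      + ∑ a, (network V W (x i) - y i) a *
          ∑ j, V a j * (reluDeriv s ((W *ᵥ (x i).ofLp) j) * ((W' - W) *ᵥ (x i).ofLp) j)
      + ‖network V W (x i) - y i‖ * (b₁ * √K * twoInftyNorm (W' - W))
      + b₀ ^ 2 / 2 * specNorm (W' - W) ^ 2) := by
          unfold trainLoss
          gcongr with i
          exact sqLoss_network_le hs hb₀ hb₁ h₀ h₁ (x i) (hx i)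
            ((card_reluRem_ne_zero_le s hβ hW hW' (x i) (hx i)).trans (hK i)) (y i)
      _ = _ := by
          simp only [Finset.sum_add_distrib, ← Finset.sum_mul, mul_add, Finset.sum_const,
            Finset.card_univ, Fintype.card_fin, nsmul_eq_mul, hL, trainLoss]
          field_simp
  unfold SemiSmooth
  refine hsum.trans (add_le_add (add_le_add_right ?_ _) ?_)
  · calc _ ≤ √2 * √L * (b₁ * √K * twoInftyNorm (W' - W)) := by gcongr
      _ = √L * twoInftyNorm (W' - W) * (√2 * (b₁ * √K)) := by ring
      _ ≤ √L * twoInftyNorm (W' - W) *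
          (C₁ * (τ ^ (2 / 3 : ℝ) * m * √(Real.log m) / √(k : ℝ))) := by gcongr
      _ = _ := by ring
  · gcongr

/-! ### Failure probabilities of the initialization -/

instance isProbabilityMeasure_gaussianMatrix (p q : ℕ) (v : ℝ≥0) :
    IsProbabilityMeasure (gaussianMatrix p q v) := by
  unfold gaussianMatrix
  infer_instance

/-- Lets each of the two bad events for V fit into half of the budget exp(-q) - exp(-2q). For small
q this budget is only of order q, so the surplus X must be at least of order 1 / q. -/
lemma exp_neg_add_le_half_sub {q X : ℝ} (hq : 0 < q) (hX : 0 ≤ X) (h : 2 + q ≤ X * q) :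
    Real.exp (-(q + X)) ≤ (Real.exp (-q) - Real.exp (-(2 * q))) / 2 := by
  have hinv : ∀ t : ℝ, 0 ≤ t → Real.exp (-t) ≤ 1 / (1 + t) := by
    intro t ht
    rw [Real.exp_neg, ← one_div]
    exact one_div_le_one_div_of_le (by positivity) (by linarith [Real.add_one_le_exp t])
  have h1 := hinv q hq.le
  have h2 := hinv X hX
  have h3 : 1 / (1 + X) ≤ (1 - 1 / (1 + q)) / 2 := by
    have e : (1 - 1 / (1 + q)) / 2 = q / (2 * (1 + q)) := by
      field_simp
      ring
    rw [e, div_le_div_iff₀ (by positivity) (by positivity)]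
    linarith
  have h4 : Real.exp (-X) ≤ (1 - Real.exp (-q)) / 2 := by linarith
  have h5 : Real.exp (-(2 * q)) = Real.exp (-q) * Real.exp (-q) := by
    rw [← Real.exp_add]
    congr 1
    ring
  have h6 : Real.exp (-(q + X)) = Real.exp (-q) * Real.exp (-X) := by
    rw [← Real.exp_add]
    congr 1
    ring
  rw [h5, h6]
  nlinarith [Real.exp_pos (-q)]

lemma five_pow_le_exp (N : ℕ) : (5 : ℝ) ^ N ≤ Real.exp (2 * N) := by
  have h : (5 : ℝ) ≤ Real.exp 2 := by
    have e : Real.exp 2 = Real.exp 1 * Real.exp 1 := by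
      rw [← Real.exp_add]
      norm_num
    rw [e]
    nlinarith [Real.exp_one_gt_d9]
  calc (5 : ℝ) ^ N ≤ Real.exp 2 ^ N := by gcongr
    _ = Real.exp (2 * N) := by
      rw [← Real.exp_nat_mul]
      congr 1
      ring

/-- The spectral norm of the output layer is of order `√(m / k)`. -/
lemma gaussianMatrix_not_columnBound_univ {k m : ℕ} (hk : 0 < k) {A D : ℝ} (hA : 0 ≤ A)
    (hD : 0 ≤ D) (hkm : (k : ℝ) ≤ A * m) :
    gaussianMatrix k m (1 / (k : ℝ≥0))
        {V | ¬ ColumnBound V Finset.univ (4 * √(2 * (2 * (A + 1) + D) * m / k))}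
      ≤ ENNReal.ofReal (Real.exp (-(D * m))) := by
  have hk' : (0 : ℝ) < k := by exact_mod_cast hk
  refine (gaussianMatrix_not_columnBound _ _ (Real.sqrt_nonneg _)).trans
    (ENNReal.ofReal_le_ofReal ?_)
  rw [Real.sq_sqrt (by positivity)]
  -- The nets cost 5^(k+m) ≤ exp(2(k+m)) ≤ exp(2(A+1)m), which the term 2(A+1) in the threshold pays
  -- for.
  calc _ ≤ Real.exp (2 * ((k + (Finset.univ : Finset (Fin m)).card : ℕ) : ℝ)) *
        Real.exp (-((2 * (A + 1) + D) * m)) := by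
        gcongr
        · exact five_pow_le_exp _
        · apply le_of_eq
          push_cast
          field_simp
    _ ≤ _ := by
        rw [← Real.exp_add]
        gcongr
        push_cast
        simp only [Finset.card_univ, Fintype.card_fin]
        linarith

/-- All submatrices of the output layer on at most `B q` columns have spectral norm of order
`√(q log m / k)`. -/
lemma gaussianMatrix_not_columnBound_sparse {k m : ℕ} (hk : 0 < k) (hm : 2 ≤ m) {A B D q : ℝ}
    (hA : 0 ≤ A) (hB : 0 ≤ B) (hD : 0 ≤ D) (hq : 0 ≤ q)
    (hkq : (k : ℝ) ≤ A * (q * Real.log m)) :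
    gaussianMatrix k m (1 / (k : ℝ≥0))
        {V | ∃ S : Finset (Fin m), S.Nonempty ∧ (S.card : ℝ) ≤ B * q ∧
          ¬ ColumnBound V S (4 * √(2 * (5 * B + 2 * A + 2 * D) * (q * Real.log m) / k))}
      ≤ ENNReal.ofReal (Real.exp (-(D * q))) := by
  have hk' : (0 : ℝ) < k := by exact_mod_cast hk
  have hm' : (2 : ℝ) ≤ m := by exact_mod_cast hm
  have hlog : 1 / 2 ≤ Real.log m :=
    (by linarith [Real.log_two_gt_d9] : (1 / 2 : ℝ) ≤ Real.log 2).trans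
      (Real.log_le_log (by norm_num) hm')
  have hBq : 0 ≤ B * q := by positivity
  have hfl : (⌊B * q⌋₊ : ℝ) ≤ B * q := Nat.floor_le hBq
  simp only [← Nat.le_floor_iff hBq]
  refine (gaussianMatrix_not_columnBound_card_le _ _ (Real.sqrt_nonneg _)).trans
    (ENNReal.ofReal_le_ofReal ?_)
  rw [Real.sq_sqrt (by positivity)]
  set s := ⌊B * q⌋₊
  calc _ ≤ Real.exp (s * Real.log m) * (Real.exp (2 * ((k + s : ℕ) : ℝ)) *
        Real.exp (-((5 * B + 2 * A + 2 * D) * (q * Real.log m)))) := by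
        gcongr
        · rw [Real.exp_nat_mul, Real.exp_log (by linarith)]
        · exact five_pow_le_exp _
        · apply le_of_eq
          push_cast
          field_simp
    _ ≤ _ := by
        rw [← Real.exp_add, ← Real.exp_add]
        gcongr
        push_cast
        -- In units of q log m: choosing the columns costs B, the nets cost 2A for k and 4B for s,
        -- and the target exponent costs 2D. The factors 2 from q ≤ 2 q log m use log m ≥ 1/2.
        have h1 : s * Real.log m ≤ B * q * Real.log m := by gcongr
        have h2 : q ≤ 2 * (q * Real.log m) := by nlinarith
        have h3 : B * q ≤ B * (2 * (q * Real.log m)) := by gcongr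
        have h4 : D * q ≤ D * (2 * (q * Real.log m)) := by gcongr
        linarith

lemma initLaw_union_le {m d k : ℕ} (E : Set (Fin m → Fin d → ℝ)) (F : Set (Fin k → Fin m → ℝ)) :
    initLaw m d k (E ×ˢ Set.univ ∪ Set.univ ×ˢ F)
      ≤ gaussianMatrix m d (2 / (m : ℝ≥0)) E + gaussianMatrix k m (1 / (k : ℝ≥0)) F := by
  refine (measure_union_le _ _).trans (le_of_eq ?_)
  simp [initLaw, Measure.prod_prod]

/-- The output layer violates one of the two spectral norm bounds only with small probability. -/
lemma gaussianMatrix_bad_output_le {m k : ℕ} (hk : 0 < k) (hm : 2 ≤ m) {A B q : ℝ}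
    (hA : 0 < A) (hB : 0 ≤ B) (hq : 0 < q) (hkm : (k : ℝ) ≤ A * m) (hqm : q ≤ (1 + A) * m)
    (hkq : (k : ℝ) ≤ A * (q * Real.log m)) :
    gaussianMatrix k m (1 / (k : ℝ≥0))
        ({V | ¬ ColumnBound V Finset.univ (4 * √(2 * (2 * (A + 1) + (2 + 5 * A)) * m / k))} ∪
          {V | ∃ S : Finset (Fin m), S.Nonempty ∧ (S.card : ℝ) ≤ B * q ∧
            ¬ ColumnBound V S (4 * √(2 * (5 * B + 2 * A + 2 * (1 + 2 * B ^ 2 + B))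
              * (q * Real.log m) / k))})
      ≤ ENNReal.ofReal (Real.exp (-q) - Real.exp (-(2 * q))) := by
  have hm' : (2 : ℝ) ≤ m := by exact_mod_cast hm
  have hk' : (1 : ℝ) ≤ k := by exact_mod_cast hk
  have hmono : 0 ≤ (Real.exp (-q) - Real.exp (-(2 * q))) / 2 := by
    have : Real.exp (-(2 * q)) ≤ Real.exp (-q) := Real.exp_le_exp.2 (by linarith)
    linarith
  have h1 : gaussianMatrix k m (1 / (k : ℝ≥0))
      {V | ¬ ColumnBound V Finset.univ (4 * √(2 * (2 * (A + 1) + (2 + 5 * A)) * m / k))}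
      ≤ ENNReal.ofReal ((Real.exp (-q) - Real.exp (-(2 * q))) / 2) := by
    refine (gaussianMatrix_not_columnBound_univ hk hA.le (by positivity) hkm).trans
      (ENNReal.ofReal_le_ofReal ?_)
    -- Since q ≤ (1+A)m, the exponent (2+5A)m is at least q + (1+4A)m. The surplus suffices because
    -- 1 ≤ k ≤ A q log m ≤ A q m.
    refine le_trans ?_ (exp_neg_add_le_half_sub (X := (1 + 4 * A) * m) hq (by positivity) ?_)
    · gcongr
      linarith
    · have hlog : Real.log m ≤ m := Real.log_le_self (by positivity)
      have h2 : A * (q * Real.log m) ≤ A * (q * m) := by gcongr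
      nlinarith
  have h2 : gaussianMatrix k m (1 / (k : ℝ≥0))
      {V | ∃ S : Finset (Fin m), S.Nonempty ∧ (S.card : ℝ) ≤ B * q ∧
            ¬ ColumnBound V S (4 * √(2 * (5 * B + 2 * A + 2 * (1 + 2 * B ^ 2 + B))
              * (q * Real.log m) / k))}
      ≤ ENNReal.ofReal ((Real.exp (-q) - Real.exp (-(2 * q))) / 2) := by
    -- If Bq < 1, no nonempty set is small enough and the event is empty. If Bq ≥ 1, the surplus
    -- (2B² + B)q meets the requirement, since 2(Bq)² ≥ 2 and Bq · q ≥ q.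
    rcases lt_or_ge (B * q) 1 with hBq | hBq
    · refine le_trans (le_of_eq ?_) zero_le
      rw [← measure_empty (μ := gaussianMatrix k m (1 / (k : ℝ≥0)))]
      congr 1
      refine Set.eq_empty_of_forall_notMem ?_
      rintro V ⟨S, hS, hcard, -⟩
      have : (1 : ℝ) ≤ S.card := by exact_mod_cast hS.card_pos
      linarith
    · refine (gaussianMatrix_not_columnBound_sparse hk hm hA.le hB (by positivity) hq.le hkq).trans
        (ENNReal.ofReal_le_ofReal ?_)
      refine le_of_eq_of_le ?_
        (exp_neg_add_le_half_sub (X := (2 * B ^ 2 + B) * q) hq (by positivity) ?_)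
      · congr 1
        ring
      · nlinarith
  refine (measure_union_le _ _).trans ((add_le_add h1 h2).trans (le_of_eq ?_))
  rw [← ENNReal.ofReal_add hmono hmono]
  congr 1
  ring

end TwoLayerReLU

/-! ### Choice of constants and assembly -/

theorem mainTheorem5 (A : ℝ) (hA : 0 < A) :
    ∃ C₁ C₂ c : ℝ, 0 < C₁ ∧ 0 < C₂ ∧ 0 < c ∧
      ∀ (n m d k : ℕ) (_ : 0 < n) (_ : 0 < k)
        (x : Fin n → EuclideanSpace ℝ (Fin d)) (_ : ∀ i, ‖x i‖ = 1)
        (y : Fin n → EuclideanSpace ℝ (Fin k))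
        (s : ℝ) (_ : s ∈ Set.Icc (0 : ℝ) 1)
        (τ : ℝ) (_ : 0 < τ) (_ : τ ≤ A)
        (_ : (k : ℝ) ≤ A * m)
        (_ : (k : ℝ) ≤ A * (m * τ ^ (2 / 3 : ℝ) * Real.log m))
        (_ : Real.log n ≤ A * (m * τ ^ (2 / 3 : ℝ))),
        TwoLayerReLU.initLaw m d k
            {ω | ¬ ∀ What ∈ TwoLayerReLU.specBall (Matrix.of ω.1) τ,
                ∀ Wtilde ∈ TwoLayerReLU.specBall (Matrix.of ω.1) τ,
                  TwoLayerReLU.SemiSmooth C₁ C₂ s τ x y (Matrix.of ω.2) Wtilde What}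
          ≤ ENNReal.ofReal (Real.exp (-(c * (m * τ ^ (2 / 3 : ℝ))))) := by
  -- A + 4 bounds the near rows and 2 the neurons moved by W or W', all in units of q.
  obtain ⟨B, hBdef⟩ : ∃ B, B = A + 6 := ⟨_, rfl⟩
  have hB : 0 < B := by rw [hBdef]; positivity
  obtain ⟨K₀, hK₀def⟩ : ∃ K, K = 2 * (A + 1) + (2 + 5 * A) := ⟨_, rfl⟩
  obtain ⟨K₁, hK₁def⟩ : ∃ K, K = 5 * B + 2 * A + 2 * (1 + 2 * B ^ 2 + B) := ⟨_, rfl⟩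
  have hK₀ : 0 < K₀ := by rw [hK₀def]; positivity
  have hK₁ : 0 < K₁ := by rw [hK₁def]; positivity
  refine ⟨8 * √(K₁ * B), 16 * K₀, 1, by positivity, by positivity, one_pos, ?_⟩
  intro n m d k hn hk x hx y s hs τ hτ hτA hkm hkq hnq
  have hk' : (0 : ℝ) < k := by exact_mod_cast hk
  -- For m = 0 or 1 the right side of `hkq` vanishes, contradicting k ≥ 1.
  have hm : 2 ≤ m := by
    by_contra! hlt
    have : m = 0 ∨ m = 1 := by lia
    rcases this with rfl | rfl <;> simp at hkq <;> lia
  have hm' : (2 : ℝ) ≤ m := by exact_mod_cast hm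
  have hlog : 0 ≤ Real.log m := Real.log_natCast_nonneg m
  obtain ⟨p, hp⟩ : ∃ p, p = τ ^ (2 / 3 : ℝ) := ⟨_, rfl⟩
  have hp0 : 0 < p := by rw [hp]; positivity
  have hp3 : p ^ 3 = τ ^ 2 := by
    rw [hp, ← Real.rpow_natCast, ← Real.rpow_mul hτ.le, ← Real.rpow_natCast]
    norm_num
  have hpA : p ≤ 1 + A := by
    by_contra! hlt
    have h1 : τ ^ 2 ≤ (1 + A) ^ 2 := by gcongr; linarith
    have h2 : (1 + A) ^ 3 < p ^ 3 := by gcongr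
    have h3 : (1 + A) ^ 2 ≤ (1 + A) ^ 3 := pow_le_pow_right₀ (by linarith) (by norm_num)
    linarith
  rw [← hp] at hkq hnq ⊢
  obtain ⟨q, hq⟩ : ∃ q, q = m * p := ⟨_, rfl⟩
  rw [← hq] at hkq hnq ⊢
  have hq0 : 0 < q := by rw [hq]; positivity
  have hqm : q ≤ (1 + A) * m := by
    rw [hq, mul_comm]
    gcongr
  have hsm : 0 < √(m : ℝ) := Real.sqrt_pos.2 (by linarith)
  have hβ : 0 < p / √m := by positivity
  have hW := TwoLayerReLU.gaussianMatrix_exists_nearCount_ge_le (m := m) hn (by lia) x hx hβ.le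
    ((A + 4) * q)
  have hV := TwoLayerReLU.gaussianMatrix_bad_output_le hk hm hA hB.le hq0 hkm hqm hkq
  rw [← hK₀def, ← hK₁def] at hV
  refine le_trans (measure_mono ?_) ((TwoLayerReLU.initLaw_union_le _ _).trans
    ((add_le_add hW hV).trans ?_))
  · intro ω hω
    by_contra hcon
    simp only [Set.mem_union, Set.mem_prod, Set.mem_univ, and_true, true_and, not_or,
      Set.mem_ofPred_eq, not_exists, not_le, not_not, not_and] at hcon
    obtain ⟨hcount, h₀, h₁⟩ := hcon
    refine hω fun W hWb W' hW'b => ?_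
    refine TwoLayerReLU.semiSmooth_of_columnBound (W₀ := Matrix.of ω.1) (K := B * q) hn hs x hx y
      hβ (by positivity) (by positivity) h₀ h₁ (fun i => ?_) ?_ ?_ hWb hW'b
    -- With p³ = τ² and β = p / √m, the Chebyshev count τ² / β² is exactly mp = q.
    · have e : τ ^ 2 / (p / √m) ^ 2 = q := by
        rw [← hp3, div_pow, Real.sq_sqrt (by linarith), hq]
        field_simp
      rw [e, hBdef]
      have := hcount i
      change (TwoLayerReLU.nearCount ω.1 (x i) (p / √m) : ℝ) + 2 * q ≤ (A + 6) * q
      linarith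
    · rw [← hp]
      apply le_of_eq
      have e1 : √(2 * K₁ * (q * Real.log m) / k) = √2 * √K₁ * (√q * √(Real.log m)) / √k := by
        rw [Real.sqrt_div (by positivity), Real.sqrt_mul (by positivity),
          Real.sqrt_mul (by positivity), Real.sqrt_mul hq0.le]
      rw [e1, Real.sqrt_mul hB.le, Real.sqrt_mul hK₁.le, mul_comm p, ← hq]
      have e2 : √2 * √2 = (2 : ℝ) := Real.mul_self_sqrt (by norm_num)
      have e3 : √q * √q = q := Real.mul_self_sqrt hq0.le
      calc _ = (√2 * √2) * (√q * √q) * (4 * √K₁ * √B * √(Real.log m) / √k) := by ring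
        _ = _ := by
          rw [e2, e3]
          ring
    · rw [mul_pow, Real.sq_sqrt (by positivity)]
      apply le_of_eq
      ring
  -- The threshold (A+4)q absorbs log n ≤ Aq and the Chernoff mean term 2q, leaving exp(-2q); the
  -- budget for V then completes exp(-q).
  · have e : Real.log n + 2 * (m * (p / √m * √m)) - (A + 4) * q ≤ -(2 * q) := by
      rw [div_mul_cancel₀ _ hsm.ne', ← hq]
      linarith
    have hmono : 0 ≤ Real.exp (-q) - Real.exp (-(2 * q)) := by
      have : Real.exp (-(2 * q)) ≤ Real.exp (-q) := Real.exp_le_exp.2 (by linarith)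
      linarith
    rw [← ENNReal.ofReal_add (Real.exp_pos _).le hmono]
    refine ENNReal.ofReal_le_ofReal ?_
    have := Real.exp_le_exp.2 e
    rw [one_mul]
    linarith
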